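/- For integers $k\ge 0$ and $p\ge 1$, let the order-$k$ Bell number $b_k(p)$ be the number of $k$-level hierarchical partitions of $[p]=\{1,\dots,p\}$, i.e. of tuples $(T_1,\dots,T_k)$ of partitions of $[p]$ into non-empty parts such that $T_i$ is a refinement of $T_{i-1}$ for $i=2,\dots,k$ (so $b_0(p)=1$). Let $\log_e^{(k)}$ be the $k$-fold iterated natural logarithm, with $\log_e^{(0)}p=p$, let $\log^*_e p$ be the smallest $k\ge 0$ with $\log_e^{(k)}p\le 1$, and put $k_0=k_0(p)=\log^*_e p-1$. **Theorem.** There are absolute constants $0<c\le C$ such that the following bounds hold for all integers $p\ge 1$ and $k\ge 0$. - If $k\le k_0$, then $$c\,\frac{p}{\log_e^{(k)}p}\;\le\; b_k(p)^{1/p}\;\le\; C\,\frac{p}{\log_e^{(k)}p}.$$ - If $k>k_0$, then $$c\,p\,(k-k_0)^{1-1/p}\;\le\; b_k(p)^{1/p}\;\le\; C\,p\,(k-k_0)^{1-1/p}$$ and $$c\,p\,\min\bigl(k^{1-1/p},\,k-k_0\bigr)\;\le\; b_k(p)^{1/p}\;\le\; C\,p\,\min\bigl(k^{1-1/p},\,k-k_0\bigr)$$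 (with the convention $0^0=1$, which matters only for $p=1$, $k=0$). In other words, $b_k(p)^{1/p}=\Theta(p/\log_e^{(k)}p)$ for $k\le k_0$, and $b_k(p)^{1/p}=\Theta(p(k-k_0)^{1-1/p})=\Theta(p\min(k^{1-1/p},k-k_0))$ for $k>k_0$, uniformly in $p$ and $k$. -/

import Mathlib

/-- Sanity of the definition of `log*`: iterating the natural logarithm eventually gives a
value `≤ 1`. -/
theorem exists_iterate_log_le_one (x : ℝ) : ∃ k : ℕ, Real.log^[k] x ≤ 1 := by
  by_contra! h
  have key : ∀ k : ℕ, Real.log^[k] x ≤ x - k := by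
    intro k
    induction k with
    | zero => simp
    | succ k ih =>
      rw [Function.iterate_succ_apply']
      have := Real.log_le_sub_one_of_pos (lt_trans one_pos (h k))
      push_cast
      linarith
  obtain ⟨n, hn⟩ := exists_nat_gt x
  linarith [key n, h n]

open Classical in
/-- `log*_e x`: the smallest `k` such that the `k`-fold iterated natural logarithm of `x`
is at most `1`. All the earlier iterates exceed `1`, so every logarithm taken is genuine. -/
noncomputable def logStar (x : ℝ) : ℕ := Nat.find (exists_iterate_log_le_one x)

/-- The threshold `k₀ = log*_e p - 1`, an integer (it equals `-1` for `p = 1`, and is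
nonnegative for `p ≥ 2`). -/
noncomputable def kZero (p : ℕ) : ℤ := (logStar (p : ℝ) : ℤ) - 1

/-- A `k`-level hierarchical partition of a `p`-element set: a tuple of `k` set partitions, each
of which is a refinement of the preceding one. (`Q ≤ P` in `Finpartition` means that every part
of `Q` is contained in a part of `P`.) -/
def HierarchicalPartition (k p : ℕ) : Type :=
  {T : Fin k → Finpartition (Finset.univ : Finset (Fin p)) //
    ∀ i j : Fin k, (j : ℕ) = (i : ℕ) + 1 → T j ≤ T i}

/-- The order-`k` Bell number `b_k(p)`: the number of `k`-level hierarchical partitions of a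
`p`-element set. -/
noncomputable def orderBell (k p : ℕ) : ℕ := Nat.card (HierarchicalPartition k p)

/-!
Write `a_k(p) = b_k(p) / p!`. A hierarchical partition is a descending chain of equivalence
relations; its finest member `r` can be chosen first, and the rest is a chain of equivalence
relations on the set of classes of `r` (`orderBell_succ`). On generating functions this says that
`A_{k+1}(x) = A_k(f x)` with `f x = exp x - 1` (`bellCoeff_succ`), so that `A_k = exp ∘ f^[k]`.

*Upper bounds.* All coefficients are nonnegative, hence `a_k(p) x ^ p ≤ f^[k+1] x` for every
`x ≥ 0` (`orderBell_mul_pow_le`). For `k ≤ k₀` take `x = log^[k] p`, where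
`f^[k+1] x ≤ exp^[k+1] x = exp p`. For `k = k₀ + m` with `m ≥ 1` there are two choices, giving the
two terms of the minimum. Since `f (1 / n) ≤ 1 / (n - 1)`, the point `1 / (m + 1)` reaches at most
`1` after `m` steps, and the other `k₀ + 1` steps cost at most `exp p` (`orderBell_add_le`); and
from `1 / (2 (k + 1))` all `k + 1` steps stay at most `1 / (k + 1)`, which saves a factor `k + 1`
when `k` is large (`orderBell_le_pow_mul_pow`).

*Lower bounds.* If `p ≤ exp^[k] y` with `y ≥ 2`, then `b_k(p) ≥ (c p / y) ^ p`, by induction on `k`: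
let the finest partition have `j = ⌊p / y⌋` blocks, which can be done in at least `j ^ (p - j)`
ways, and apply the induction hypothesis to `(j, exp y)`; this costs a factor
`exp (-y j) ≥ exp (-p)`, and the constant from the previous level enters with
exponent only `j ≤ p / 2`, so that it does not degenerate (`orderBell_ge_of_le_iterate_exp`). At `k = k₀` this gives `a_k(q) ≥ c ^ q` for all
`q ≤ p`. Composing `m` more times with `f`, which dominates `x + x ^ 2 / 2`, is at least as good
as composing with the Möbius map `x / (1 - c x)`, and turns the bound `c ^ q` into
`c ^ q (m + 1) ^ (q - 1)` (`bellCoeff_add_ge`).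
-/

/-! ### Descending chains in a preorder -/

/-- The set of weakly descending `k`-tuples in a preorder. -/
abbrev DescChain (k : ℕ) (α : Type*) [Preorder α] : Type _ :=
  {T : Fin k → α // Antitone T}

namespace DescChain

variable {α β : Type*} [Preorder α] [Preorder β]

/-- Descending chains are transported along an order isomorphism. -/
def congr (k : ℕ) (e : α ≃o β) : DescChain k α ≃ DescChain k β where
  toFun T := ⟨fun i => e (T.1 i), e.monotone.comp_antitone T.2⟩
  invFun T := ⟨fun i => e.symm (T.1 i), e.symm.monotone.comp_antitone T.2⟩
  left_inv T := by ext; simp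
  right_inv T := by ext; simp

theorem sigma_ext {k : ℕ} {x y : Σ r : α, DescChain k {s : α // r ≤ s}} (h1 : x.1 = y.1)
    (h2 : ∀ i, (x.2.1 i : α) = y.2.1 i) : x = y := by
  obtain ⟨r, S, hS⟩ := x
  obtain ⟨r', S', hS'⟩ := y
  obtain rfl : r = r' := h1
  congr
  ext i
  exact h2 i

/-- A descending chain of length `k + 1` consists of its last, smallest, entry `r` and of a
descending chain of length `k` above `r`. -/
def succEquiv (k : ℕ) (α : Type*) [Preorder α] :
    DescChain (k + 1) α ≃ Σ r : α, DescChain k {s : α // r ≤ s} where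
  toFun T := ⟨T.1 (Fin.last k), fun i => ⟨T.1 i.castSucc, T.2 (Fin.le_last _)⟩,
    fun _ _ h => T.2 (Fin.castSucc_le_castSucc_iff.2 h)⟩
  invFun S := ⟨Fin.snoc (α := fun _ => α) (fun i => (S.2.1 i : α)) S.1, by
    intro i j hij
    induction j using Fin.lastCases with
    | last =>
      induction i using Fin.lastCases with
      | last => exact le_rfl
      | cast i => simpa using (S.2.1 i).2
    | cast j =>
      induction i using Fin.lastCases with
      | last => exact absurd hij (not_le.2 (Fin.castSucc_lt_last j))
      | cast i => simpa using S.2.2 (Fin.castSucc_le_castSucc_iff.1 hij)⟩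
  left_inv T := by
    ext i
    induction i using Fin.lastCases <;> simp
  right_inv S := sigma_ext (by simp) (by simp)

end DescChain

theorem antitone_fin_iff {α : Type*} [Preorder α] {k : ℕ} {T : Fin k → α} :
    Antitone T ↔ ∀ i j : Fin k, (j : ℕ) = (i : ℕ) + 1 → T j ≤ T i := by
  refine ⟨fun h i j hij => h (Fin.le_def.2 (by omega)), fun h => ?_⟩
  cases k with
  | zero => exact fun i => i.elim0
  | succ k => exact Fin.antitone_iff_succ_le.2 fun i => h _ _ (by simp)

/-! ### Partitions as equivalence relations -/

/-- Partitions of a finite type, ordered by refinement, are the same as equivalence relations. -/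
noncomputable def finpartitionOrderIsoSetoid (α : Type*) [Fintype α] [DecidableEq α] :
    Finpartition (Finset.univ : Finset α) ≃o Setoid α :=
  RelIso.ofSurjective
    (OrderEmbedding.ofMapLEIff (fun P => Setoid.ker P.part) (by
      intro P Q
      change Setoid.ker P.part ≤ Setoid.ker Q.part ↔ P ≤ Q
      constructor
      · intro h A hA
        obtain ⟨a, ha⟩ := P.nonempty_of_mem_parts hA
        refine ⟨Q.part a, Q.part_mem.2 (Finset.mem_univ a), fun b hb => ?_⟩
        rw [Q.mem_part_iff_part_eq_part (Finset.mem_univ _) (Finset.mem_univ _)]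
        refine @h b a ?_
        rw [Setoid.ker_def, P.part_eq_of_mem hA ha, P.part_eq_of_mem hA hb]
      · intro h x y (hxy : P.part x = P.part y)
        rw [Setoid.ker_def]
        obtain ⟨B, hB, hPB⟩ := h (P.part_mem.2 (Finset.mem_univ x))
        rw [Q.part_eq_of_mem hB (hPB (P.mem_part_self.2 (Finset.mem_univ x))),
          Q.part_eq_of_mem hB (hPB (hxy ▸ P.mem_part_self.2 (Finset.mem_univ y)))]))
    (by
      classical
      intro r
      refine ⟨Finpartition.ofSetoid r, Setoid.ext fun x y => ?_⟩
      change (Finpartition.ofSetoid r).part x = (Finpartition.ofSetoid r).part y ↔ r x y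
      rw [← Finpartition.mem_part_iff_part_eq_part _ (Finset.mem_univ _) (Finset.mem_univ _),
        Finpartition.mem_part_ofSetoid_iff_rel]
      exact r.comm')

/-- A bijection between two types induces an isomorphism between their lattices of
equivalence relations. -/
def Setoid.congrOrderIso {α β : Type*} (e : α ≃ β) : Setoid α ≃o Setoid β where
  toFun r := r.comap e.symm
  invFun r := r.comap e
  left_inv r := by ext; simp [Setoid.comap_rel]
  right_inv r := by ext; simp [Setoid.comap_rel]
  map_rel_iff' {r s} := by
    refine ⟨fun h x y hxy => ?_, fun h _ _ hxy => h hxy⟩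
    have h' : r (e.symm (e x)) (e.symm (e y)) → s (e.symm (e x)) (e.symm (e y)) := @h (e x) (e y)
    simp only [Equiv.symm_apply_apply] at h'
    exact h' hxy

theorem orderBell_eq_card_descChain (k p : ℕ) :
    orderBell k p = Nat.card (DescChain k (Setoid (Fin p))) := by
  rw [← Nat.card_congr (DescChain.congr k (finpartitionOrderIsoSetoid (Fin p)))]
  exact Nat.card_congr (Equiv.subtypeEquivRight fun T => antitone_fin_iff.symm)

theorem orderBell_nat_card (k : ℕ) (α : Type*) [Finite α] :
    orderBell k (Nat.card α) = Nat.card (DescChain k (Setoid α)) := by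
  rw [orderBell_eq_card_descChain]
  exact Nat.card_congr
    (DescChain.congr k (Setoid.congrOrderIso (Finite.equivFin α).symm))

instance Setoid.finite {α : Type*} [Finite α] : Finite (Setoid α) :=
  Finite.of_injective (fun r : Setoid α => (r : α → α → Prop)) fun _ _ => Setoid.eq_iff_rel_eq.2

noncomputable instance Setoid.fintypeOfFinite {α : Type*} [Finite α] : Fintype (Setoid α) :=
  Fintype.ofFinite _

theorem orderBell_zero (p : ℕ) : orderBell 0 p = 1 := by
  rw [orderBell_eq_card_descChain, Nat.card_eq_one_iff_unique]
  exact ⟨⟨fun S T => Subtype.ext (Subsingleton.elim _ _)⟩, ⟨⟨Fin.elim0, fun i => i.elim0⟩⟩⟩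

/-- Choosing the finest partition first, the rest of a hierarchical partition is a hierarchical
partition of the set of its blocks. -/
theorem orderBell_succ (k p : ℕ) :
    orderBell (k + 1) p = ∑ r : Setoid (Fin p), orderBell k (Nat.card (Quotient r)) := by
  rw [orderBell_eq_card_descChain, Nat.card_congr (DescChain.succEquiv k _), Nat.card_sigma]
  refine Finset.sum_congr rfl fun r _ => ?_
  rw [orderBell_nat_card]
  exact Nat.card_congr (DescChain.congr k (Setoid.correspondence r))

/-! ### Counting equivalence relations by their number of classes -/

/-- The number of equivalence relations on an `n`-element set with exactly `j` classes. -/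
noncomputable def numSetoids (n j : ℕ) : ℕ :=
  (Finset.univ.filter fun r : Setoid (Fin n) => Nat.card (Quotient r) = j).card

theorem sum_setoid_eq (n N : ℕ) (g : ℕ → ℕ)
    (h : ∀ r : Setoid (Fin n), N ≤ Nat.card (Quotient r) → g (Nat.card (Quotient r)) = 0) :
    ∑ r : Setoid (Fin n), g (Nat.card (Quotient r)) =
      ∑ j ∈ Finset.range N, numSetoids n j * g j := by
  simp only [numSetoids, Finset.card_filter, Finset.sum_mul]
  rw [Finset.sum_comm]
  refine Finset.sum_congr rfl fun r _ => ?_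
  simp only [ite_mul, one_mul, zero_mul, Finset.sum_ite_eq, Finset.mem_range]
  split_ifs with hr
  · rfl
  · exact h r (not_lt.1 hr)

/-- A map into an `m`-element set is an equivalence relation (its kernel) together with an
injection of the set of classes. -/
theorem sum_numSetoids_mul_descFactorial (n m : ℕ) :
    ∑ j ∈ Finset.range (m + 1), numSetoids n j * m.descFactorial j = m ^ n := by
  rw [← sum_setoid_eq n (m + 1) m.descFactorial
    fun r hr => Nat.descFactorial_eq_zero_iff_lt.2 hr]
  have h1 : ∀ r : Setoid (Fin n),
      m.descFactorial (Nat.card (Quotient r)) = Nat.card (Quotient r ↪ Fin m) := by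
    intro r
    classical
    rw [Nat.card_eq_fintype_card, Nat.card_eq_fintype_card, Fintype.card_embedding_eq,
      Fintype.card_fin]
  simp only [h1]
  rw [← Nat.card_sigma]
  have h2 : Nat.card (Fin n → Fin m) = m ^ n := by simp
  rw [← h2]
  refine Nat.card_congr (Equiv.ofBijective
    (fun x : Σ r : Setoid (Fin n), (Quotient r ↪ Fin m) => fun i => x.2 (Quotient.mk x.1 i))
    ⟨?_, ?_⟩)
  · rintro ⟨r, e⟩ ⟨r', e'⟩ h
    have h' : ∀ i, e (Quotient.mk r i) = e' (Quotient.mk r' i) := fun i => congrFun h i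
    have hr : r = r' := by
      ext x y
      rw [← Quotient.eq (r := r), ← Quotient.eq (r := r'), ← e.injective.eq_iff,
        ← e'.injective.eq_iff, h', h']
    subst hr
    congr
    ext q
    induction q using Quotient.inductionOn with
    | h i => rw [h' i]
  · intro f
    exact ⟨⟨Setoid.ker f, ⟨Setoid.kerLift f, Setoid.kerLift_injective f⟩⟩, rfl⟩

/-! ### The exponential generating function -/

/-- The coefficient of `x ^ n` in `(exp x - 1) ^ j`. -/
noncomputable def expSubOneCoeff (n j : ℕ) : ℝ :=
  PowerSeries.coeff n ((PowerSeries.exp ℝ - 1) ^ j)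

theorem sum_expSubOneCoeff_mul_choose (n m : ℕ) :
    ∑ j ∈ Finset.range (m + 1), expSubOneCoeff n j * m.choose j = (m : ℝ) ^ n / (n.factorial) := by
  have h : PowerSeries.coeff n (PowerSeries.exp ℝ ^ m) = (m : ℝ) ^ n / (n.factorial) := by
    rw [PowerSeries.exp_pow_eq_rescale_exp, PowerSeries.coeff_rescale, PowerSeries.coeff_exp]
    simp [div_eq_mul_inv]
  rw [← h, ← sub_add_cancel (PowerSeries.exp ℝ) 1, add_pow, map_sum]
  refine Finset.sum_congr rfl fun j _ => ?_
  rw [expSubOneCoeff, one_pow, mul_one, mul_comm _ (m.choose j : PowerSeries ℝ),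
    ← nsmul_eq_mul, map_nsmul, nsmul_eq_mul, mul_comm]

/-- The exponential generating function, in the size of the set, of the number of partitions
into `j` blocks is `(exp x - 1) ^ j / j!`. Both sides solve the same triangular system. -/
theorem numSetoids_mul_factorial (n j : ℕ) :
    (numSetoids n j : ℝ) * (j.factorial) = (n.factorial) * expSubOneCoeff n j := by
  induction j using Nat.strong_induction_on with
  | _ j ih =>
    have h1 := sum_numSetoids_mul_descFactorial n j
    have h2 := sum_expSubOneCoeff_mul_choose n j
    rw [Finset.sum_range_succ] at h1 h2
    rw [Nat.choose_self, Nat.cast_one, mul_one] at h2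
    rw [Nat.descFactorial_self] at h1
    have hn : ((n.factorial) : ℝ) ≠ 0 := by positivity
    have h3 : ∑ i ∈ Finset.range j, (numSetoids n i : ℝ) * (j.descFactorial i : ℝ) =
        (n.factorial) * ∑ i ∈ Finset.range j, expSubOneCoeff n i * j.choose i := by
      rw [Finset.mul_sum]
      refine Finset.sum_congr rfl fun i hi => ?_
      rw [Nat.descFactorial_eq_factorial_mul_choose, ← mul_assoc, ← ih i (Finset.mem_range.1 hi)]
      push_cast
      ring
    have h1' : ∑ i ∈ Finset.range j, (numSetoids n i : ℝ) * (j.descFactorial i : ℝ) +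
        numSetoids n j * (j.factorial) = (j : ℝ) ^ n := by exact_mod_cast h1
    rw [eq_div_iff hn] at h2
    linarith

/-- `orderBell k p / p!`, the coefficient of the exponential generating function. -/
noncomputable def bellCoeff (k p : ℕ) : ℝ := orderBell k p / (p.factorial)

theorem bellCoeff_zero (p : ℕ) : bellCoeff 0 p = 1 / (p.factorial) := by
  simp [bellCoeff, orderBell_zero]

/-- The generating function at level `k + 1` is the one at level `k` composed with `exp x - 1`. -/
theorem bellCoeff_succ {k p N : ℕ} (hN : p < N) :
    bellCoeff (k + 1) p = ∑ j ∈ Finset.range N, expSubOneCoeff p j * bellCoeff k j := by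
  have h := sum_setoid_eq p N (orderBell k) (fun r hr => by
    have h1 := Nat.card_le_card_of_surjective (Quotient.mk r) Quotient.mk_surjective
    rw [Nat.card_fin] at h1
    omega)
  rw [bellCoeff, orderBell_succ, h, div_eq_iff (by positivity), Finset.sum_mul]
  push_cast
  refine Finset.sum_congr rfl fun j _ => ?_
  have h2 := numSetoids_mul_factorial p j
  have hj : ((j.factorial) : ℝ) ≠ 0 := by positivity
  rw [bellCoeff]
  field_simp
  linear_combination (orderBell k j : ℝ) * h2

theorem expSubOneCoeff_zero_right (n : ℕ) : expSubOneCoeff n 0 = if n = 0 then 1 else 0 := by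
  simp [expSubOneCoeff, PowerSeries.coeff_one]

theorem coeff_exp_sub_one (n : ℕ) :
    PowerSeries.coeff n (PowerSeries.exp ℝ - 1) = if n = 0 then 0 else 1 / (n.factorial : ℝ) := by
  rw [map_sub, PowerSeries.coeff_exp, PowerSeries.coeff_one]
  split_ifs with h
  · simp [h]
  · simp

theorem expSubOneCoeff_succ_right (n j : ℕ) :
    expSubOneCoeff n (j + 1) = ∑ x ∈ Finset.HasAntidiagonal.antidiagonal n,
      expSubOneCoeff x.1 j * if x.2 = 0 then 0 else 1 / (x.2.factorial : ℝ) := by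
  simp only [expSubOneCoeff, pow_succ _ j, PowerSeries.coeff_mul, coeff_exp_sub_one]

theorem expSubOneCoeff_nonneg (n j : ℕ) : 0 ≤ expSubOneCoeff n j := by
  induction j generalizing n with
  | zero => rw [expSubOneCoeff_zero_right]; positivity
  | succ j ih =>
    rw [expSubOneCoeff_succ_right]
    exact Finset.sum_nonneg fun x _ => mul_nonneg (ih _) (by positivity)

theorem bellCoeff_nonneg (k p : ℕ) : 0 ≤ bellCoeff k p := by
  unfold bellCoeff; positivity

theorem bellCoeff_zero_right (k : ℕ) : bellCoeff k 0 = 1 := by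
  induction k with
  | zero => simp [bellCoeff_zero]
  | succ k ih => simp [bellCoeff_succ (Nat.lt_succ_self 0), ih, expSubOneCoeff_zero_right]

/-! ### Upper bounds -/

/-- A truncated Cauchy product is at most the product of the truncations. -/
theorem sum_range_sum_antidiagonal_le {u v : ℕ → ℝ} (hu : ∀ n, 0 ≤ u n) (hv : ∀ n, 0 ≤ v n)
    (N : ℕ) :
    ∑ n ∈ Finset.range N, ∑ x ∈ Finset.HasAntidiagonal.antidiagonal n, u x.1 * v x.2 ≤
      (∑ n ∈ Finset.range N, u n) * ∑ n ∈ Finset.range N, v n := by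
  rw [Finset.sum_mul_sum, ← Finset.sum_product', ← Finset.sum_biUnion]
  · refine Finset.sum_le_sum_of_subset_of_nonneg (fun x hx => ?_)
      fun x _ _ => mul_nonneg (hu _) (hv _)
    simp only [Finset.mem_biUnion, Finset.mem_range, Finset.HasAntidiagonal.mem_antidiagonal] at hx
    obtain ⟨n, hn, h⟩ := hx
    simp only [Finset.mem_product, Finset.mem_range]
    omega
  · intro a _ b _ hab
    refine Finset.disjoint_left.2 fun x hx hx' => hab ?_
    rw [Finset.HasAntidiagonal.mem_antidiagonal] at hx hx'
    exact hx.symm.trans hx'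

theorem sum_expSubOneCoeff_mul_pow_le {x : ℝ} (hx : 0 ≤ x) (N j : ℕ) :
    ∑ n ∈ Finset.range N, expSubOneCoeff n j * x ^ n ≤ (Real.exp x - 1) ^ j := by
  have h0 : 0 ≤ Real.exp x - 1 := by linarith [Real.one_le_exp hx]
  induction j with
  | zero =>
    simp only [expSubOneCoeff_zero_right, ite_mul, one_mul, zero_mul, Finset.sum_ite_eq',
      Finset.mem_range, pow_zero]
    split_ifs <;> simp
  | succ j ih =>
    have h1 : ∑ n ∈ Finset.range N, (if n = 0 then 0 else 1 / (n.factorial : ℝ)) * x ^ n ≤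
        Real.exp x - 1 := by
      cases N with
      | zero => simpa using h0
      | succ N =>
        have h := Real.sum_le_exp_of_nonneg hx (N + 1)
        rw [Finset.sum_range_succ'] at h ⊢
        simp only [Nat.succ_ne_zero, if_false, if_true, zero_mul, add_zero, one_div,
          inv_mul_eq_div]
        simp only [pow_zero, Nat.factorial_zero, Nat.cast_one, div_one] at h
        linarith
    have h2 := sum_range_sum_antidiagonal_le (u := fun n => expSubOneCoeff n j * x ^ n)
      (v := fun n => (if n = 0 then 0 else 1 / (n.factorial : ℝ)) * x ^ n)
      (fun n => mul_nonneg (expSubOneCoeff_nonneg _ _) (by positivity))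
      (fun n => by positivity) N
    calc ∑ n ∈ Finset.range N, expSubOneCoeff n (j + 1) * x ^ n
        = ∑ n ∈ Finset.range N, ∑ y ∈ Finset.HasAntidiagonal.antidiagonal n,
          (expSubOneCoeff y.1 j * x ^ y.1) *
            ((if y.2 = 0 then 0 else 1 / (y.2.factorial : ℝ)) * x ^ y.2) := by
          refine Finset.sum_congr rfl fun n _ => ?_
          rw [expSubOneCoeff_succ_right, Finset.sum_mul]
          refine Finset.sum_congr rfl fun y hy => ?_
          rw [← Finset.HasAntidiagonal.mem_antidiagonal.1 hy, pow_add]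
          ring
      _ ≤ _ := h2
      _ ≤ (Real.exp x - 1) ^ j * (Real.exp x - 1) := by
          refine mul_le_mul ih h1 (Finset.sum_nonneg fun n _ => by positivity) (by positivity)
      _ = _ := (pow_succ _ _).symm

/-- The function `x ↦ exp x - 1`, whose iterates are the generating functions of the higher order
Bell numbers. -/
noncomputable def expSubOne (x : ℝ) : ℝ := Real.exp x - 1

theorem expSubOne_nonneg {x : ℝ} (hx : 0 ≤ x) : 0 ≤ expSubOne x := by
  unfold expSubOne; linarith [Real.one_le_exp hx]

theorem expSubOne_mono : Monotone expSubOne := fun _ _ h =>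
  sub_le_sub_right (Real.exp_le_exp.2 h) 1

theorem iterate_expSubOne_le_iterate_exp (x : ℝ) (k : ℕ) : expSubOne^[k] x ≤ Real.exp^[k] x :=
  expSubOne_mono.iterate_le_of_le (fun y => by unfold expSubOne; linarith) k x

/-- The generating function at level `k` is `exp` of the `k`-th iterate of `exp x - 1`. -/
theorem sum_bellCoeff_mul_pow_le (k N : ℕ) {x : ℝ} (hx : 0 ≤ x) :
    ∑ p ∈ Finset.range N, bellCoeff k p * x ^ p ≤ Real.exp (expSubOne^[k] x) := by
  induction k generalizing x with
  | zero =>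
    simpa [bellCoeff_zero, inv_mul_eq_div] using Real.sum_le_exp_of_nonneg hx N
  | succ k ih =>
    calc ∑ p ∈ Finset.range N, bellCoeff (k + 1) p * x ^ p
        = ∑ p ∈ Finset.range N, ∑ j ∈ Finset.range N,
            bellCoeff k j * (expSubOneCoeff p j * x ^ p) := by
          refine Finset.sum_congr rfl fun p hp => ?_
          rw [bellCoeff_succ (Finset.mem_range.1 hp), Finset.sum_mul]
          exact Finset.sum_congr rfl fun j _ => by ring
      _ = ∑ j ∈ Finset.range N, bellCoeff k j *
            ∑ p ∈ Finset.range N, expSubOneCoeff p j * x ^ p := by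
          rw [Finset.sum_comm]
          simp only [Finset.mul_sum]
      _ ≤ ∑ j ∈ Finset.range N, bellCoeff k j * expSubOne x ^ j :=
          Finset.sum_le_sum fun j _ => mul_le_mul_of_nonneg_left
            (sum_expSubOneCoeff_mul_pow_le hx N j) (bellCoeff_nonneg k j)
      _ ≤ _ := ih (expSubOne_nonneg hx)

/-- Saddle point bound: a coefficient is at most the value of the series divided by the power of
the argument. -/
theorem orderBell_mul_pow_le (k : ℕ) {p : ℕ} (hp : 1 ≤ p) {x : ℝ} (hx : 0 ≤ x) :
    orderBell k p * x ^ p ≤ (p : ℝ) ^ p * expSubOne^[k + 1] x := by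
  have h1 := sum_bellCoeff_mul_pow_le k (p + 1) hx
  have h2 : bellCoeff k p * x ^ p ≤ expSubOne^[k + 1] x := by
    rw [Finset.sum_range_succ'] at h1
    have h3 := Finset.single_le_sum (f := fun i => bellCoeff k (i + 1) * x ^ (i + 1))
      (fun i _ => mul_nonneg (bellCoeff_nonneg _ _) (pow_nonneg hx _))
      (Finset.mem_range.2 (Nat.sub_lt hp one_pos))
    simp only [Nat.sub_add_cancel hp] at h3
    rw [bellCoeff_zero_right] at h1
    rw [Function.iterate_succ_apply', expSubOne]
    linarith
  have h3 : (orderBell k p : ℝ) = p.factorial * bellCoeff k p := by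
    rw [bellCoeff]; field_simp
  rw [h3, mul_assoc]
  refine mul_le_mul (by exact_mod_cast Nat.factorial_le_pow p) h2
    (mul_nonneg (bellCoeff_nonneg _ _) (pow_nonneg hx _)) (by positivity)

/-- Near `0` the map `exp x - 1` is below `x / (1 - x)`, which sends `1 / n` to `1 / (n - 1)`. -/
theorem iterate_expSubOne_one_div_le {n : ℝ} (j : ℕ) (hj : (j : ℝ) < n) :
    expSubOne^[j] (1 / n) ≤ 1 / (n - j) := by
  induction j with
  | zero => simp
  | succ j ih =>
    push_cast at hj ⊢
    rw [Function.iterate_succ_apply']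
    refine (expSubOne_mono (ih (by linarith))).trans ?_
    set t := n - j with ht
    have ht1 : 0 < t - 1 := by linarith
    have h1 : 1 - 1 / t ≤ Real.exp (-(1 / t)) := Real.one_sub_le_exp_neg _
    rw [Real.exp_neg] at h1
    have h2 : 0 < 1 - 1 / t := by
      have : 1 / t < 1 := by rw [div_lt_one] <;> linarith
      linarith
    have h3 : Real.exp (1 / t) ≤ 1 / (1 - 1 / t) := by
      rw [le_div_iff₀ h2]
      have := mul_le_mul_of_nonneg_left h1 (Real.exp_pos (1 / t)).le
      rwa [mul_inv_cancel₀ (Real.exp_ne_zero _)] at this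
    have h4 : 1 / (1 - 1 / t) - 1 = 1 / (t - 1) := by
      have : t ≠ 0 := by linarith
      have h' : t - 1 ≠ 0 := ht1.ne'
      field_simp
      ring
    have h5 : n - (j + 1) = t - 1 := by rw [ht]; ring
    rw [h5, expSubOne]
    linarith

theorem orderBell_le_of_iterate_exp_le {k p : ℕ} (hp : 1 ≤ p) {x : ℝ} (hx : 0 < x)
    (h : Real.exp^[k] x ≤ p) : (orderBell k p : ℝ) ≤ (Real.exp 1 * (p / x)) ^ p := by
  have h1 := orderBell_mul_pow_le k hp hx.le
  have h2 : expSubOne^[k + 1] x ≤ Real.exp 1 ^ p := by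
    rw [← Real.exp_nat_mul, mul_one]
    refine (iterate_expSubOne_le_iterate_exp x (k + 1)).trans ?_
    rw [Function.iterate_succ_apply']
    exact Real.exp_le_exp.2 h
  rw [mul_div_assoc', div_pow, le_div_iff₀ (by positivity), mul_pow, mul_comm (Real.exp 1 ^ p)]
  exact h1.trans (mul_le_mul_of_nonneg_left h2 (by positivity))

/-- The bound that is sharp when `k` is large: the argument `1 / (2 (k + 1))` stays small under
all iterates. -/
theorem orderBell_le_pow_mul_pow (k : ℕ) {p : ℕ} (hp : 1 ≤ p) :
    (orderBell k p : ℝ) ≤ (2 * p) ^ p * ((k : ℝ) + 1) ^ (p - 1) := by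
  have h1 := orderBell_mul_pow_le k hp (x := 1 / (2 * ((k : ℝ) + 1))) (by positivity)
  have h2 := iterate_expSubOne_one_div_le (n := 2 * ((k : ℝ) + 1)) (k + 1)
    (by push_cast; linarith [k.cast_nonneg (α := ℝ)])
  rw [show 2 * ((k : ℝ) + 1) - ((k + 1 : ℕ) : ℝ) = k + 1 by push_cast; ring] at h2
  have h3 := h1.trans (mul_le_mul_of_nonneg_left h2 (by positivity))
  rw [one_div_pow, mul_one_div, div_le_iff₀ (by positivity)] at h3
  refine h3.trans (le_of_eq ?_)
  obtain ⟨q, rfl⟩ : ∃ q, p = q + 1 := ⟨p - 1, by omega⟩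
  rw [Nat.add_sub_cancel]
  rw [mul_pow, mul_pow, pow_succ ((k : ℝ) + 1)]
  field_simp

/-- The bound that is sharp just above the threshold: `1 / (m + 1)` reaches at most `1` after `m`
iterates, and the remaining `r + 1` iterates are controlled by the tower of exponentials. -/
theorem orderBell_add_le {r p : ℕ} (hp : 1 ≤ p) (h : Real.exp^[r] 1 ≤ p) (m : ℕ) :
    (orderBell (r + m) p : ℝ) ≤ (Real.exp 1 * (p * (m + 1))) ^ p := by
  have h1 := orderBell_mul_pow_le (r + m) hp (x := 1 / ((m : ℝ) + 1)) (by positivity)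
  have h2 := iterate_expSubOne_one_div_le (n := (m : ℝ) + 1) m (by linarith)
  rw [add_sub_cancel_left, div_one] at h2
  have h3 : expSubOne^[r + m + 1] (1 / ((m : ℝ) + 1)) ≤ Real.exp 1 ^ p := by
    rw [← Real.exp_nat_mul, mul_one, show r + m + 1 = (r + 1) + m by ring,
      Function.iterate_add_apply]
    refine (expSubOne_mono.iterate (r + 1) h2).trans ?_
    refine (iterate_expSubOne_le_iterate_exp 1 (r + 1)).trans ?_
    rw [Function.iterate_succ_apply']
    exact Real.exp_le_exp.2 h
  have h4 := h1.trans (mul_le_mul_of_nonneg_left h3 (by positivity))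
  rw [one_div_pow, mul_one_div, div_le_iff₀ (by positivity)] at h4
  refine h4.trans (le_of_eq ?_)
  rw [mul_pow, mul_pow]
  ring

/-! ### Lower bounds -/

theorem natCast_mul_expSubOneCoeff_le (n j : ℕ) :
    (j : ℝ) * expSubOneCoeff n j ≤ (n + 1) * expSubOneCoeff (n + 1) j := by
  cases j with
  | zero => simpa using mul_nonneg (by positivity) (expSubOneCoeff_nonneg (n + 1) 0)
  | succ j =>
    -- compare coefficients in `(f ^ (j + 1))' = (j + 1) * (f ^ (j + 1) + f ^ j)`, `f = exp - 1`
    have h : PowerSeries.derivative ℝ ((PowerSeries.exp ℝ - 1) ^ (j + 1)) =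
        ((j + 1 : ℕ) : PowerSeries ℝ) *
          ((PowerSeries.exp ℝ - 1) ^ (j + 1) + (PowerSeries.exp ℝ - 1) ^ j) := by
      rw [PowerSeries.derivative_pow, map_sub, PowerSeries.derivative_exp,
        PowerSeries.derivative_one]
      simp only [Nat.add_sub_cancel]
      ring
    have h1 := congrArg (PowerSeries.coeff n) h
    rw [PowerSeries.coeff_derivative, ← nsmul_eq_mul, map_nsmul, nsmul_eq_mul, map_add] at h1
    have h2 := mul_nonneg (Nat.cast_nonneg (α := ℝ) (j + 1)) (expSubOneCoeff_nonneg n j)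
    simp only [expSubOneCoeff] at h2 ⊢
    rw [mul_comm (n + 1 : ℝ), h1, mul_add]
    linarith

theorem expSubOneCoeff_succ_ge (n j : ℕ) :
    expSubOneCoeff n j ≤ expSubOneCoeff (n + 1) (j + 1) := by
  rw [expSubOneCoeff_succ_right]
  have h := Finset.single_le_sum (s := Finset.HasAntidiagonal.antidiagonal (n + 1))
    (f := fun x : ℕ × ℕ =>
      expSubOneCoeff x.1 j * if x.2 = 0 then 0 else 1 / (x.2.factorial : ℝ))
    (fun x _ => mul_nonneg (expSubOneCoeff_nonneg _ _) (by positivity))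
    (Finset.HasAntidiagonal.mem_antidiagonal.2
      (rfl : ((n, 1) : ℕ × ℕ).1 + ((n, 1) : ℕ × ℕ).2 = n + 1))
  simpa using h

theorem one_le_expSubOneCoeff_self (n : ℕ) : 1 ≤ expSubOneCoeff n n := by
  induction n with
  | zero => simp [expSubOneCoeff_zero_right]
  | succ n ih => exact ih.trans (expSubOneCoeff_succ_ge n n)

/-- Keeping only the first two terms of `exp x - 1 = x + x ^ 2 / 2 + ⋯` in one factor. -/
theorem expSubOneCoeff_add_half_le (n j : ℕ) :
    expSubOneCoeff (n + 1) j + expSubOneCoeff n j / 2 ≤ expSubOneCoeff (n + 2) (j + 1) := by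
  rw [expSubOneCoeff_succ_right (n + 2) j]
  have h := Finset.sum_le_sum_of_subset_of_nonneg
    (s := {((n + 1, 1) : ℕ × ℕ), (n, 2)})
    (t := Finset.HasAntidiagonal.antidiagonal (n + 2))
    (f := fun x : ℕ × ℕ =>
      expSubOneCoeff x.1 j * if x.2 = 0 then 0 else 1 / (x.2.factorial : ℝ))
    (by
      intro x hx
      simp only [Finset.mem_insert, Finset.mem_singleton] at hx
      rw [Finset.HasAntidiagonal.mem_antidiagonal]
      rcases hx with rfl | rfl <;> rfl)
    (fun x _ _ => mul_nonneg (expSubOneCoeff_nonneg _ _) (by positivity))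
  rw [Finset.sum_pair (by simp)] at h
  norm_num [Nat.factorial] at h ⊢
  linarith

theorem expSubOneCoeff_ge (j t : ℕ) :
    (j : ℝ) ^ t * j.factorial ≤ (j + t).factorial * expSubOneCoeff (j + t) j := by
  induction t with
  | zero =>
    simpa using mul_le_mul_of_nonneg_left (one_le_expSubOneCoeff_self j)
      (Nat.cast_nonneg (α := ℝ) j.factorial)
  | succ t ih =>
    have h := natCast_mul_expSubOneCoeff_le (j + t) j
    rw [← Nat.add_assoc, Nat.factorial_succ]
    push_cast at h ⊢
    calc (j : ℝ) ^ (t + 1) * j.factorial = j * (j ^ t * j.factorial) := by ring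
      _ ≤ j * ((j + t).factorial * expSubOneCoeff (j + t) j) := by gcongr
      _ = (j + t).factorial * (j * expSubOneCoeff (j + t) j) := by ring
      _ ≤ (j + t).factorial * (((j : ℝ) + t + 1) * expSubOneCoeff (j + t + 1) j) := by gcongr
      _ = _ := by ring

/-- There are at least `j ^ (p - j)` partitions of a `p`-element set into `j` blocks. -/
theorem pow_mul_orderBell_le (k : ℕ) {j p : ℕ} (hj : j ≤ p) :
    (j : ℝ) ^ (p - j) * orderBell k j ≤ orderBell (k + 1) p := by
  have h1 : expSubOneCoeff p j * bellCoeff k j ≤ bellCoeff (k + 1) p := by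
    rw [bellCoeff_succ (Nat.lt_succ_self p)]
    exact Finset.single_le_sum (f := fun j => expSubOneCoeff p j * bellCoeff k j)
      (fun i _ => mul_nonneg (expSubOneCoeff_nonneg _ _) (bellCoeff_nonneg _ _))
      (Finset.mem_range.2 (by omega))
  have h2 := expSubOneCoeff_ge j (p - j)
  rw [Nat.add_sub_cancel' hj] at h2
  have hp : (0 : ℝ) < p.factorial := by positivity
  have hj' : (0 : ℝ) < j.factorial := by positivity
  have h3 : (orderBell k j : ℝ) = j.factorial * bellCoeff k j := by
    rw [bellCoeff]; field_simp
  have h4 : (orderBell (k + 1) p : ℝ) = p.factorial * bellCoeff (k + 1) p := by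
    rw [bellCoeff]; field_simp
  rw [h3, h4, ← mul_assoc]
  refine (mul_le_mul_of_nonneg_right h2 (bellCoeff_nonneg k j)).trans ?_
  rw [mul_assoc]
  exact mul_le_mul_of_nonneg_left h1 hp.le

theorem one_le_orderBell (k p : ℕ) : (1 : ℝ) ≤ orderBell k p := by
  induction k with
  | zero => simp [orderBell_zero]
  | succ k ih => exact ih.trans (by simpa using pow_mul_orderBell_le k (le_refl p))

/-- Lower bound below the threshold. In the induction step the finest partition has about `p / y`
blocks, which reduces the pair `(p, y)` to `(p / y, exp y)`. -/
theorem orderBell_ge_of_le_iterate_exp (k : ℕ) {p : ℕ} {y : ℝ} (hy : 2 ≤ y)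
    (h : (p : ℝ) ≤ Real.exp^[k] y) :
    ((1 / (2 * Real.exp 1)) ^ 2 * (p / y)) ^ p ≤ orderBell k p := by
  have he : 1 ≤ Real.exp 1 := Real.one_le_exp zero_le_one
  set d : ℝ := 1 / (2 * Real.exp 1) with hd
  have hd0 : 0 < d := by positivity
  have hd1 : d ≤ 1 := by rw [hd, div_le_one (by positivity)]; linarith
  -- when `q ≤ z` the bound asserted is at most `1`
  have small : ∀ (k q : ℕ) (z : ℝ), 2 ≤ z → (q : ℝ) ≤ z →
      (d ^ 2 * (q / z)) ^ q ≤ orderBell k q := by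
    intro k q z hz hqz
    have hz0 : 0 < z := by linarith
    refine le_trans (pow_le_one₀ (by positivity) ?_) (one_le_orderBell k q)
    exact mul_le_one₀ (pow_le_one₀ hd0.le hd1) (by positivity)
      (by rw [div_le_one hz0]; exact hqz)
  induction k generalizing p y with
  | zero => exact small 0 p y hy h
  | succ k ih =>
    rcases le_total (p : ℝ) y with hpy | hpy
    · exact small (k + 1) p y hy hpy
    have hy0 : 0 < y := by linarith
    set j := ⌊(p : ℝ) / y⌋₊ with hj
    have hj1 : 1 ≤ j := Nat.le_floor (by rw [Nat.cast_one, one_le_div hy0]; exact hpy)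
    have hjle : (j : ℝ) ≤ p / y := Nat.floor_le (by positivity)
    have hjlt : (p : ℝ) / y < j + 1 := Nat.lt_floor_add_one _
    have hj1' : (1 : ℝ) ≤ j := by exact_mod_cast hj1
    have hjy : (j : ℝ) * y ≤ p := (le_div_iff₀ hy0).1 hjle
    have h2j : 2 * j ≤ p := by
      have : (2 : ℝ) * j ≤ p := by nlinarith
      exact_mod_cast this
    have hjp : j ≤ p := by omega
    have hexp : 2 ≤ Real.exp y := by linarith [Real.add_one_le_exp y]
    have hjR : (j : ℝ) ≤ Real.exp^[k] (Real.exp y) := by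
      rw [← Function.iterate_succ_apply]
      exact le_trans (by exact_mod_cast hjp) h
    have h1 := ih hexp hjR
    refine le_trans ?_ (pow_mul_orderBell_le k hjp)
    refine le_trans ?_ (mul_le_mul_of_nonneg_left h1 (by positivity))
    have h3 : d ^ p ≤ (d ^ 2) ^ j := by
      rw [← pow_mul]
      exact pow_le_pow_of_le_one hd0.le hd1 h2j
    have h4 : (1 / Real.exp 1) ^ p ≤ (1 / Real.exp y) ^ j := by
      rw [one_div, one_div, ← Real.exp_neg, ← Real.exp_neg, ← Real.exp_nat_mul,
        ← Real.exp_nat_mul]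
      exact Real.exp_le_exp.2 (by linarith)
    have h5 : ((p : ℝ) / (2 * y)) ^ p ≤ (j : ℝ) ^ p := by
      refine pow_le_pow_left₀ (by positivity) ?_ p
      rw [mul_comm, ← div_div, div_le_iff₀ two_pos]
      linarith
    calc (d ^ 2 * (p / y)) ^ p = d ^ p * (1 / Real.exp 1) ^ p * (p / (2 * y)) ^ p := by
          rw [← mul_pow, ← mul_pow]
          congr 1
          rw [hd]
          field_simp
      _ ≤ (d ^ 2) ^ j * (1 / Real.exp y) ^ j * (j : ℝ) ^ p := by gcongr
      _ = (j : ℝ) ^ (p - j) * (d ^ 2 * (j / Real.exp y)) ^ j := by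
          have h6 : (j : ℝ) ^ p = j ^ (p - j) * j ^ j := by
            rw [← pow_add, Nat.sub_add_cancel hjp]
          rw [h6, ← mul_pow, mul_comm, mul_assoc, ← mul_pow]
          congr 2
          ring

/-- The coefficient of `x ^ n` in the geometric series `1 / (1 - w (exp x - 1))`. -/
noncomputable def fubiniCoeff (w : ℝ) (n : ℕ) : ℝ :=
  ∑ j ∈ Finset.range (n + 1), expSubOneCoeff n j * w ^ j

theorem fubiniCoeff_zero (w : ℝ) : fubiniCoeff w 0 = 1 := by
  simp [fubiniCoeff, expSubOneCoeff_zero_right]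

theorem le_fubiniCoeff_one {w : ℝ} (hw : 0 ≤ w) : w ≤ fubiniCoeff w 1 := by
  simp only [fubiniCoeff, Finset.sum_range_succ, Finset.range_zero, Finset.sum_empty,
    expSubOneCoeff_zero_right]
  simpa using mul_le_mul_of_nonneg_right (one_le_expSubOneCoeff_self 1) hw

theorem fubiniCoeff_add_two_ge {w : ℝ} (hw : 0 ≤ w) (n : ℕ) :
    w * fubiniCoeff w (n + 1) + w / 2 * fubiniCoeff w n ≤ fubiniCoeff w (n + 2) := by
  have h0 : fubiniCoeff w n ≤ ∑ j ∈ Finset.range (n + 2), expSubOneCoeff n j * w ^ j :=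
    Finset.sum_le_sum_of_subset_of_nonneg (Finset.range_mono (by omega))
      fun j _ _ => mul_nonneg (expSubOneCoeff_nonneg _ _) (pow_nonneg hw _)
  have h1 : fubiniCoeff w (n + 2) = ∑ j ∈ Finset.range (n + 2),
      expSubOneCoeff (n + 2) (j + 1) * w ^ (j + 1) := by
    rw [fubiniCoeff, Finset.sum_range_succ']
    simp [expSubOneCoeff_zero_right]
  calc w * fubiniCoeff w (n + 1) + w / 2 * fubiniCoeff w n
      ≤ w * fubiniCoeff w (n + 1) +
        w / 2 * ∑ j ∈ Finset.range (n + 2), expSubOneCoeff n j * w ^ j := by gcongr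
    _ = ∑ j ∈ Finset.range (n + 2),
        (expSubOneCoeff (n + 1) j + expSubOneCoeff n j / 2) * w ^ (j + 1) := by
      rw [fubiniCoeff, Finset.mul_sum, Finset.mul_sum, ← Finset.sum_add_distrib]
      exact Finset.sum_congr rfl fun j _ => by ring
    _ ≤ _ := by
      rw [h1]
      exact Finset.sum_le_sum fun j _ =>
        mul_le_mul_of_nonneg_right (expSubOneCoeff_add_half_le n j) (pow_nonneg hw _)

/-- Coefficientwise, `1 / (1 - w (exp x - 1))` dominates the geometric series
`1 + w x / (1 - (w + c) x)`, as long as the two-term recursion outgrows it. -/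
theorem mul_pow_le_fubiniCoeff {w c : ℝ} (hw : 0 ≤ w) (hc : 0 ≤ c) (hc2 : c ≤ 1 / 2)
    (h : c * (w + c) ≤ w / 2) (n : ℕ) : w * (w + c) ^ n ≤ fubiniCoeff w (n + 1) := by
  induction n using Nat.twoStepInduction with
  | zero => simpa using le_fubiniCoeff_one hw
  | one =>
    have h1 := fubiniCoeff_add_two_ge hw 0
    rw [fubiniCoeff_zero] at h1
    have h2 := mul_le_mul_of_nonneg_left (le_fubiniCoeff_one hw) hw
    have h3 := mul_le_mul_of_nonneg_left hc2 hw
    simp only [zero_add] at h1 ⊢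
    norm_num at h1 ⊢
    nlinarith
  | more n ih1 ih2 =>
    refine le_trans ?_ (fubiniCoeff_add_two_ge hw (n + 1))
    have h3 : 0 ≤ w * (w + c) ^ n := by positivity
    calc w * (w + c) ^ (n + 2) = w * (w * (w + c) ^ (n + 1)) +
          c * (w + c) * (w * (w + c) ^ n) := by ring
      _ ≤ w * fubiniCoeff w (n + 1 + 1) + w / 2 * fubiniCoeff w (n + 1) := by gcongr

/-- Adding `m` levels: a geometric lower bound `c ^ p` for the coefficients turns into
`c ^ p (m + 1) ^ (p - 1)`. These are the coefficients of `c x / (1 - (m + 1) c x)`, which is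
`c x / (1 - c x)` composed `m` times with `x / (1 - c x)`. The factor `m + 1` on the right avoids
the exponent `p - 1` and covers `p = 0`. -/
theorem bellCoeff_add_ge {r P : ℕ} {c : ℝ} (hc : 0 ≤ c) (hc4 : c ≤ 1 / 4)
    (h : ∀ p ≤ P, c ^ p ≤ bellCoeff r p) (m : ℕ) :
    ∀ p ≤ P, (c * (m + 1)) ^ p ≤ (m + 1) * bellCoeff (r + m) p := by
  induction m with
  | zero => simpa using h
  | succ m ih =>
    intro p hp
    cases p with
    | zero => simp [bellCoeff_zero_right]; linarith [m.cast_nonneg (α := ℝ)]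
    | succ p =>
      have hm : (0 : ℝ) ≤ m := m.cast_nonneg
      have h1 : fubiniCoeff (c * (m + 1)) (p + 1) ≤ (m + 1) * bellCoeff (r + (m + 1)) (p + 1) := by
        rw [← Nat.add_assoc, bellCoeff_succ (Nat.lt_succ_self (p + 1)), fubiniCoeff,
          Finset.mul_sum]
        refine Finset.sum_le_sum fun j hj => ?_
        rw [mul_left_comm]
        exact mul_le_mul_of_nonneg_left
          (ih j (by have := Finset.mem_range.1 hj; omega)) (expSubOneCoeff_nonneg _ _)
      have h2 := mul_pow_le_fubiniCoeff (w := c * (m + 1)) (c := c) (by positivity) hc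
        (by linarith) (by nlinarith [mul_nonneg hc hm]) p
      have h3 := h2.trans h1
      rw [mul_comm c, mul_assoc] at h3
      have h4 := le_of_mul_le_mul_left h3 (by positivity : (0 : ℝ) < m + 1)
      push_cast
      calc (c * ((m : ℝ) + 1 + 1)) ^ (p + 1)
          = ((m : ℝ) + 1 + 1) * (c * ((m + 1) * c + c) ^ p) := by
            rw [show ((m : ℝ) + 1) * c + c = c * (m + 1 + 1) by ring]; ring
        _ ≤ _ := by gcongr

theorem pow_le_exp_mul_factorial (p : ℕ) : ((p : ℝ) / Real.exp 1) ^ p ≤ p.factorial := by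
  have h := Real.pow_div_factorial_le_exp (p : ℝ) p.cast_nonneg p
  rw [div_le_iff₀ (by positivity)] at h
  rw [div_pow, div_le_iff₀ (by positivity), ← Real.exp_nat_mul, mul_one, mul_comm]
  exact h

/-- Lower bound above the threshold. -/
theorem orderBell_add_ge {r p : ℕ} (h : (p : ℝ) ≤ Real.exp^[r] (Real.exp 1)) (m : ℕ) :
    ((1 / (2 * Real.exp 1)) ^ 2 / Real.exp 1 ^ 2 * p) ^ p * ((m : ℝ) + 1) ^ (p - 1) ≤
      orderBell (r + m) p := by
  have he : 2 ≤ Real.exp 1 := by linarith [Real.add_one_le_exp 1]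
  set d : ℝ := (1 / (2 * Real.exp 1)) ^ 2 with hd
  have hd4 : d ≤ 1 / 4 := by
    rw [hd, show (1 / 4 : ℝ) = (1 / 2) ^ 2 by norm_num]
    gcongr
    linarith
  have h1 : ∀ q ≤ p, (d / Real.exp 1) ^ q ≤ bellCoeff r q := by
    intro q hq
    have h2 := orderBell_ge_of_le_iterate_exp r he
      (le_trans (by exact_mod_cast hq : (q : ℝ) ≤ p) h)
    rw [bellCoeff, le_div_iff₀ (by positivity)]
    refine le_trans ?_ h2
    rw [← hd, mul_div_assoc', mul_div_right_comm, mul_pow]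
    gcongr
    exact_mod_cast Nat.factorial_le_pow q
  have hde : d / Real.exp 1 ≤ 1 / 4 :=
    (div_le_self (by positivity) (by linarith)).trans hd4
  have h3 := bellCoeff_add_ge (by positivity) hde h1 m p le_rfl
  rcases Nat.eq_zero_or_pos p with rfl | hp
  · simpa using one_le_orderBell (r + m) 0
  obtain ⟨q, rfl⟩ : ∃ q, p = q + 1 := ⟨p - 1, by omega⟩
  have hm : (0 : ℝ) < m + 1 := by positivity
  rw [mul_pow, pow_succ ((m : ℝ) + 1), mul_comm (((m : ℝ) + 1) ^ q), mul_left_comm] at h3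
  have h4 := le_of_mul_le_mul_left h3 hm
  rw [bellCoeff, le_div_iff₀ (by positivity)] at h4
  refine le_trans ?_ h4
  rw [Nat.add_sub_cancel]
  calc (d / Real.exp 1 ^ 2 * ((q + 1 : ℕ) : ℝ)) ^ (q + 1) * ((m : ℝ) + 1) ^ q
      = (d / Real.exp 1) ^ (q + 1) * ((m : ℝ) + 1) ^ q *
        (((q + 1 : ℕ) : ℝ) / Real.exp 1) ^ (q + 1) := by
        rw [mul_right_comm, ← mul_pow]
        congr 2
        field_simp
    _ ≤ _ := by
        gcongr
        exact pow_le_exp_mul_factorial _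

/-! ### Iterated logarithms -/

theorem iterate_exp_iterate_log {x : ℝ} {k : ℕ} (h : ∀ i < k, 0 < Real.log^[i] x) :
    Real.exp^[k] (Real.log^[k] x) = x := by
  induction k with
  | zero => rfl
  | succ k ih =>
    rw [Function.iterate_succ_apply' Real.log, Function.iterate_succ_apply,
      Real.exp_log (h k (by omega))]
    exact ih fun i hi => h i (by omega)

theorem iterate_exp_mono (k : ℕ) : Monotone Real.exp^[k] := Real.exp_monotone.iterate k

theorem one_lt_iterate_log {x : ℝ} {i : ℕ} (h : i < logStar x) : 1 < Real.log^[i] x := by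
  classical
  exact not_le.1 (Nat.find_min (exists_iterate_log_le_one x) h)

theorem iterate_log_logStar_le_one (x : ℝ) : Real.log^[logStar x] x ≤ 1 := by
  classical
  exact Nat.find_spec (exists_iterate_log_le_one x)

theorem iterate_log_le_sub {x : ℝ} {i : ℕ} (h : i < logStar x) : Real.log^[i] x ≤ x - i := by
  induction i with
  | zero => simp
  | succ i ih =>
    rw [Function.iterate_succ_apply']
    have h1 := Real.log_le_sub_one_of_pos (one_pos.trans (one_lt_iterate_log (Nat.lt_of_succ_lt h)))
    have h2 := ih (Nat.lt_of_succ_lt h)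
    push_cast
    linarith

theorem kZero_one : kZero 1 = -1 := by
  have h : logStar ((1 : ℕ) : ℝ) = 0 := by
    by_contra hne
    have := one_lt_iterate_log (Nat.pos_of_ne_zero hne)
    simp at this
  rw [kZero, h]
  rfl

theorem exists_kZero_eq {p : ℕ} (hp : 2 ≤ p) :
    ∃ r : ℕ, kZero p = r ∧ logStar (p : ℝ) = r + 1 := by
  have h : logStar (p : ℝ) ≠ 0 := by
    intro h0
    have h1 := iterate_log_logStar_le_one (p : ℝ)
    rw [h0, Function.iterate_zero_apply] at h1
    have : (2 : ℝ) ≤ p := by exact_mod_cast hp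
    linarith
  obtain ⟨r, hr⟩ := Nat.exists_eq_succ_of_ne_zero h
  exact ⟨r, by rw [kZero, hr]; push_cast; ring, hr⟩

/-! ### Taking `p`-th roots -/

theorem pow_rpow_one_div {X : ℝ} (hX : 0 ≤ X) {p : ℕ} (hp : 1 ≤ p) :
    (X ^ p) ^ (1 / (p : ℝ)) = X := by
  rw [one_div, Real.pow_rpow_inv_natCast hX (by omega)]

theorem pow_mul_pow_rpow_one_div {X M : ℝ} (hX : 0 ≤ X) (hM : 0 ≤ M) {p : ℕ} (hp : 1 ≤ p) :
    (X ^ p * M ^ (p - 1)) ^ (1 / (p : ℝ)) = X * M ^ (1 - 1 / (p : ℝ)) := by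
  have hp0 : (p : ℝ) ≠ 0 := by positivity
  rw [Real.mul_rpow (by positivity) (by positivity), pow_rpow_one_div hX hp,
    ← Real.rpow_natCast M, ← Real.rpow_mul hM]
  congr 2
  rw [Nat.cast_sub hp]
  field_simp
  norm_num

theorem rpow_one_div_le {b X M : ℝ} (hb : 0 ≤ b) (hX : 0 ≤ X) (hM : 0 ≤ M) {p : ℕ} (hp : 1 ≤ p)
    (h : b ≤ X ^ p * M ^ (p - 1)) : b ^ (1 / (p : ℝ)) ≤ X * M ^ (1 - 1 / (p : ℝ)) := by
  rw [← pow_mul_pow_rpow_one_div hX hM hp]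
  exact Real.rpow_le_rpow hb h (by positivity)

theorem le_rpow_one_div {b X M : ℝ} (hX : 0 ≤ X) (hM : 0 ≤ M) {p : ℕ} (hp : 1 ≤ p)
    (h : X ^ p * M ^ (p - 1) ≤ b) : X * M ^ (1 - 1 / (p : ℝ)) ≤ b ^ (1 / (p : ℝ)) := by
  rw [← pow_mul_pow_rpow_one_div hX hM hp]
  exact Real.rpow_le_rpow (by positivity) h (by positivity)

/-- The two forms of the bound above the threshold agree up to a factor `2`. If `m < r ≤ p`, then
`m ^ (1 / p) ≤ 2`; otherwise `r + m ≤ 2 * m`. -/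
theorem min_rpow_le {p r m : ℕ} (hp : 1 ≤ p) (hr : r ≤ p) (hm : 1 ≤ m) :
    min (((r + m : ℕ) : ℝ) ^ (1 - 1 / (p : ℝ))) (m : ℝ) ≤ 2 * (m : ℝ) ^ (1 - 1 / (p : ℝ)) := by
  have hp' : (1 : ℝ) ≤ p := by exact_mod_cast hp
  have hm' : (1 : ℝ) ≤ m := by exact_mod_cast hm
  have hinv : 1 / (p : ℝ) ≤ 1 := by rw [div_le_one (by linarith)]; exact hp'
  have hinv0 : 0 ≤ 1 / (p : ℝ) := by positivity
  rcases le_total r m with hrm | hrm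
  · refine (min_le_left _ _).trans ?_
    calc ((r + m : ℕ) : ℝ) ^ (1 - 1 / (p : ℝ)) ≤ (2 * (m : ℝ)) ^ (1 - 1 / (p : ℝ)) := by
          refine Real.rpow_le_rpow (by positivity) ?_ (by linarith)
          exact_mod_cast (by omega : r + m ≤ 2 * m)
      _ = 2 ^ (1 - 1 / (p : ℝ)) * (m : ℝ) ^ (1 - 1 / (p : ℝ)) :=
          Real.mul_rpow (by norm_num) (by positivity)
      _ ≤ 2 * (m : ℝ) ^ (1 - 1 / (p : ℝ)) := by
          gcongr
          exact Real.rpow_le_self_of_one_le (by norm_num) (by linarith)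
  · refine (min_le_right _ _).trans ?_
    have h1 : (m : ℝ) ^ (1 / (p : ℝ)) ≤ 2 := by
      have h2 : (m : ℝ) ≤ 2 ^ p := by
        exact_mod_cast (hrm.trans hr).trans Nat.lt_two_pow_self.le
      calc (m : ℝ) ^ (1 / (p : ℝ)) ≤ ((2 : ℝ) ^ p) ^ (1 / (p : ℝ)) :=
            Real.rpow_le_rpow (by positivity) h2 hinv0
        _ = 2 := pow_rpow_one_div two_pos.le hp
    calc (m : ℝ) = (m : ℝ) ^ (1 / (p : ℝ)) * (m : ℝ) ^ (1 - 1 / (p : ℝ)) := by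
          rw [← Real.rpow_add (by linarith), add_sub_cancel, Real.rpow_one]
      _ ≤ _ := by gcongr

/-! ### The bounds on either side of the threshold -/

theorem orderBell_rpow_bounds_below {p k : ℕ} (hp : 1 ≤ p) (hk : k < logStar (p : ℝ)) :
    (1 / (2 * Real.exp 1)) ^ 2 / 2 * ((p : ℝ) / Real.log^[k] (p : ℝ)) ≤
        (orderBell k p : ℝ) ^ (1 / (p : ℝ)) ∧
      (orderBell k p : ℝ) ^ (1 / (p : ℝ)) ≤ Real.exp 1 * ((p : ℝ) / Real.log^[k] (p : ℝ)) := by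
  have hx := one_lt_iterate_log hk
  have hexp : Real.exp^[k] (Real.log^[k] (p : ℝ)) = p :=
    iterate_exp_iterate_log fun i hi => one_pos.trans (one_lt_iterate_log (hi.trans hk))
  set x := Real.log^[k] (p : ℝ)
  have hx0 : 0 < x := by linarith
  constructor
  · have h := orderBell_ge_of_le_iterate_exp k (y := 2 * x) (by linarith)
      (hexp.symm.le.trans (iterate_exp_mono k (by linarith)))
    have h1 := Real.rpow_le_rpow (by positivity) h (by positivity : 0 ≤ 1 / (p : ℝ))
    rw [pow_rpow_one_div (by positivity) hp] at h1
    refine le_trans (le_of_eq ?_) h1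
    field_simp
  · have h := orderBell_le_of_iterate_exp_le hp hx0 hexp.le
    have h1 := Real.rpow_le_rpow (by positivity) h (by positivity : 0 ≤ 1 / (p : ℝ))
    rwa [pow_rpow_one_div (by positivity) hp] at h1

theorem orderBell_rpow_bounds_above {p r m : ℕ} (hp : 2 ≤ p) (hr : logStar (p : ℝ) = r + 1)
    (hm : 1 ≤ m) :
    (1 / (2 * Real.exp 1)) ^ 2 / Real.exp 1 ^ 2 * (p * (m : ℝ) ^ (1 - 1 / (p : ℝ))) ≤
        (orderBell (r + m) p : ℝ) ^ (1 / (p : ℝ)) ∧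
      (orderBell (r + m) p : ℝ) ^ (1 / (p : ℝ)) ≤
        6 * (p * min (((r + m : ℕ) : ℝ) ^ (1 - 1 / (p : ℝ))) (m : ℝ)) := by
  have hp1 : 1 ≤ p := by omega
  have hp' : (1 : ℝ) ≤ p := by exact_mod_cast hp1
  have hm' : (1 : ℝ) ≤ m := by exact_mod_cast hm
  have hθ : 1 / (p : ℝ) ≤ 1 := by rw [div_le_one (by linarith)]; exact hp'
  have hθ0 : 0 ≤ 1 / (p : ℝ) := by positivity
  have hx : 1 < Real.log^[r] (p : ℝ) := one_lt_iterate_log (by omega)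
  have hexp : Real.exp^[r] (Real.log^[r] (p : ℝ)) = p :=
    iterate_exp_iterate_log fun i hi => one_pos.trans (one_lt_iterate_log (by omega))
  have hxe : Real.log^[r] (p : ℝ) ≤ Real.exp 1 := by
    have h := iterate_log_logStar_le_one (p : ℝ)
    rw [hr, Function.iterate_succ_apply'] at h
    exact (Real.log_le_iff_le_exp (by linarith)).1 h
  constructor
  · have h := orderBell_add_ge (hexp.symm.le.trans (iterate_exp_mono r hxe)) m
    have h1 := le_rpow_one_div (by positivity) (by positivity) hp1 h
    refine le_trans ?_ h1
    rw [← mul_assoc]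
    gcongr
    linarith
  · have hk : ((r + m : ℕ) : ℝ) + 1 ≤ 2 * ((r + m : ℕ) : ℝ) := by
      exact_mod_cast (by omega : r + m + 1 ≤ 2 * (r + m))
    have h1 := rpow_one_div_le (Nat.cast_nonneg _) (by positivity) (by positivity) hp1
      (orderBell_le_pow_mul_pow (r + m) hp1)
    have h2 : (((r + m : ℕ) : ℝ) + 1) ^ (1 - 1 / (p : ℝ)) ≤
        2 * ((r + m : ℕ) : ℝ) ^ (1 - 1 / (p : ℝ)) := by
      refine (Real.rpow_le_rpow (by positivity) hk (by linarith)).trans ?_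
      rw [Real.mul_rpow (by norm_num) (by positivity)]
      gcongr
      exact Real.rpow_le_self_of_one_le (by norm_num) (by linarith)
    have h3 := Real.rpow_le_rpow (by positivity)
      (orderBell_add_le hp1 ((iterate_exp_mono r hx.le).trans hexp.le) m) hθ0
    rw [pow_rpow_one_div (by positivity) hp1] at h3
    rw [mul_min_of_nonneg _ _ (by positivity), mul_min_of_nonneg _ _ (by norm_num)]
    refine le_min ?_ ?_
    · refine h1.trans ((mul_le_mul_of_nonneg_left h2 (by positivity)).trans ?_)
      have : 0 ≤ (p : ℝ) * ((r + m : ℕ) : ℝ) ^ (1 - 1 / (p : ℝ)) := by positivity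
      linarith
    · refine h3.trans ?_
      have he : Real.exp 1 ≤ 3 := by linarith [Real.exp_one_lt_d9]
      calc Real.exp 1 * (p * ((m : ℝ) + 1)) ≤ 3 * (p * (m + m)) := by gcongr
        _ = 6 * (p * m) := by ring

theorem mainTheorem4 :
    ∃ c C : ℝ, 0 < c ∧ 0 < C ∧
      ∀ p k : ℕ, 1 ≤ p →
        ((k : ℤ) ≤ kZero p →
          c * ((p : ℝ) / Real.log^[k] (p : ℝ)) ≤ (orderBell k p : ℝ) ^ (1 / (p : ℝ)) ∧
          (orderBell k p : ℝ) ^ (1 / (p : ℝ)) ≤ C * ((p : ℝ) / Real.log^[k] (p : ℝ))) ∧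
        (kZero p < (k : ℤ) →
          (c * ((p : ℝ) * ((k : ℝ) - (kZero p : ℝ)) ^ (1 - 1 / (p : ℝ))) ≤
              (orderBell k p : ℝ) ^ (1 / (p : ℝ)) ∧
            (orderBell k p : ℝ) ^ (1 / (p : ℝ)) ≤
              C * ((p : ℝ) * ((k : ℝ) - (kZero p : ℝ)) ^ (1 - 1 / (p : ℝ)))) ∧
          (c * ((p : ℝ) * min ((k : ℝ) ^ (1 - 1 / (p : ℝ))) ((k : ℝ) - (kZero p : ℝ))) ≤
              (orderBell k p : ℝ) ^ (1 / (p : ℝ)) ∧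
            (orderBell k p : ℝ) ^ (1 / (p : ℝ)) ≤
              C * ((p : ℝ) *
                min ((k : ℝ) ^ (1 - 1 / (p : ℝ))) ((k : ℝ) - (kZero p : ℝ))))) := by
  have he1 : 1 ≤ Real.exp 1 := Real.one_le_exp zero_le_one
  have he3 : Real.exp 1 ≤ 3 := by linarith [Real.exp_one_lt_d9]
  set d : ℝ := (1 / (2 * Real.exp 1)) ^ 2 with hd
  have hd0 : 0 < d := by positivity
  set c : ℝ := d / Real.exp 1 ^ 2 with hc
  have hc0 : 0 < c := by positivity
  have hcd : c ≤ d := div_le_self hd0.le (one_le_pow₀ he1)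
  have hd1 : d ≤ 1 := pow_le_one₀ (by positivity) (by rw [div_le_one (by positivity)]; linarith)
  refine ⟨c / 2, 12, by positivity, by norm_num, fun p k hp => ⟨fun hk => ?_, fun hk => ?_⟩⟩
  · have hk' : k < logStar (p : ℝ) := by unfold kZero at hk; omega
    obtain ⟨h1, h2⟩ := orderBell_rpow_bounds_below hp hk'
    have h0 : 0 ≤ (p : ℝ) / Real.log^[k] (p : ℝ) :=
      div_nonneg p.cast_nonneg (one_pos.trans (one_lt_iterate_log hk')).le
    refine ⟨le_trans ?_ h1, h2.trans ?_⟩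
    · gcongr
    · exact mul_le_mul_of_nonneg_right (by linarith) h0
  · obtain rfl | hp2 : p = 1 ∨ 2 ≤ p := by omega
    · have h1 := one_le_orderBell k 1
      have h2 := orderBell_le_pow_mul_pow k (le_refl 1)
      rw [kZero_one]
      norm_num at h2 ⊢
      exact ⟨by linarith, by omega⟩
    · obtain ⟨r, hr, hrs⟩ := exists_kZero_eq hp2
      rw [hr] at hk ⊢
      obtain ⟨m, rfl⟩ : ∃ m, k = r + m := ⟨k - r, by omega⟩
      have hm : 1 ≤ m := by omega
      have hrp : r ≤ p := by
        have h1 := one_lt_iterate_log (x := (p : ℝ)) (i := r) (by omega)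
        have h2 := iterate_log_le_sub (x := (p : ℝ)) (i := r) (by omega)
        have h3 : (r : ℝ) ≤ p := by linarith
        exact_mod_cast h3
      have hsub : ((r + m : ℕ) : ℝ) - (((r : ℕ) : ℤ) : ℝ) = m := by push_cast; ring
      rw [hsub]
      obtain ⟨h1, h2⟩ := orderBell_rpow_bounds_above hp2 hrs hm
      have h3 := min_rpow_le hp hrp hm
      have hp0 : (0 : ℝ) ≤ p := p.cast_nonneg
      have h4 := mul_le_mul_of_nonneg_left h3 hp0
      have h5 := mul_le_mul_of_nonneg_left h4 hc0.le
      have h6 : 0 ≤ c * ((p : ℝ) * (m : ℝ) ^ (1 - 1 / (p : ℝ))) := by positivity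
      have h7 : 0 ≤ (p : ℝ) * min (((r + m : ℕ) : ℝ) ^ (1 - 1 / (p : ℝ))) (m : ℝ) := by positivity
      refine ⟨⟨?_, ?_⟩, ?_, ?_⟩ <;> linarith
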